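/- Fix integers $q\ge 2$ and $k\ge 2$. A \emph{power circuit} (to base $q$) is a pair $(\Gamma,\delta)$ with a finite set $\Gamma$ of nodes and a map $\delta:\Gamma\times\Gamma\to\{-q+1,\dots,q-1\}$ such that the directed graph on $\Gamma$ whose edges are the pairs $(P,Q)$ with $\delta(P,Q)\ne 0$ is acyclic and every node has evaluation in $\{q^i : i\in\mathbb N\}$. Here a \emph{marking} is a map $M:\Gamma\to\{-q+1,\dots,q-1\}$, the \emph{successor marking} of $P\in\Gamma$ is $\Lambda_P=\delta(P,\cdot)$, and the evaluations are defined recursively along the graph by $\varepsilon(P)=q^{\varepsilon(\Lambda_P)}$ and $\varepsilon(M)=\sum_{P\in\Gamma}M(P)\,\varepsilon(P)$. A marking $M$ is \emph{compact} if for all $P\neq Q$ with $M(P)\ne 0\ne M(Q)$ we have $\varepsilon(P)\neq\varepsilon(Q)$ and, whenever $|M(P)|=|M(Q)|=q-1$ or $\operatorname{sgn}M(P)\ne\operatorname{sgn}M(Q)$, also $|\varepsilon(\Lambda_P)-\varepsilon(\Lambda_Q)|\ge 2$. A \emph{reduced} power circuit is a power circuit whose nodes are given as a list $P_0,\dots,P_{n-1}$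 with $\varepsilon(P_0)<\dots<\varepsilon(P_{n-1})$ and all of whose successor markings are compact. Then the following problem is in (non-uniform) $\mathsf{TC}^0$. \emph{Input:} a reduced power circuit $(\Gamma,\delta)$ to base $q$ and a compact marking $M$ on $\Gamma$, given in binary by the $n\times n$ matrix of $\delta$ and the sequence of the $n$ values of $M$, each entry being written with a fixed number of bits (a sign bit and the absolute value in binary). \emph{Output:} the residue $\varepsilon(M)\bmod k\in\{0,\dots,k-1\}$, written in an arbitrary fixed-length binary format. That is, for every fixed-length binary format for the residues $0,\dots,k-1$ there is a family $(C_N)_{N\in\mathbb N}$ of Boolean circuits with $\mathrm{Not}$, $\mathrm{And}$, $\mathrm{Or}$ and $\mathrm{Majority}$ gates of unbounded fan-in ($\mathrm{Not}$ gates having exactly one input), of size polynomial in $N$ and of depth bounded by a constant, such that for every such input, encoded by a word of length $N$, the circuit $C_N$ outputs $\varepsilon(M)\bmod k$ on that word. The polynomial and the depth bound may depend on $q$, $k$ and the format only. -/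

import Mathlib

/-! ## Threshold circuits and the (non-uniform) class `TC⁰` -/

namespace TC

/-- The types of the internal gates of a threshold circuit. -/
inductive GateKind where
  | not
  | and
  | or
  | majority

/-- The output of a gate of a given type that receives `ones` many ones and `zeros` many zeros on
its incoming wires (for a `not` gate there is exactly one incoming wire). -/
def GateKind.output : GateKind → (ones zeros : ℕ) → Bool
  | .not, ones, _ => decide (ones = 0)
  | .and, _, zeros => decide (zeros = 0)
  | .or, ones, _ => decide (ones ≠ 0)
  | .majority, ones, zeros => decide (zeros < ones)

/-- A Boolean circuit with input gates `x_0, …, x_{n-1}`, with `m` numbered output gates, and with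
internal `not`, `and`, `or` and `majority` gates of unbounded fan-in. It is a finite directed
acyclic graph on the vertex set `Fin n ⊕ Gate`; `preds g` is the set of the vertices from which a
wire leads to `g`. Acyclicity is expressed as well-foundedness (the graph is finite). -/
structure Circuit (n m : ℕ) where
  Gate : Type
  fintypeGate : Fintype Gate
  kind : Gate → GateKind
  preds : Gate → Finset (Fin n ⊕ Gate)
  card_preds_of_not : ∀ g, kind g = GateKind.not → (preds g).card = 1
  acyclic : WellFounded fun h g : Gate => Sum.inr h ∈ preds g
  out : Fin m → Fin n ⊕ Gate

namespace Circuit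

variable {n m : ℕ}

/-- The value that `g` receives from its predecessor `v` on the input `x`, given the values `ih` of
the internal gates among the predecessors of `g`. -/
def wireVal (C : Circuit n m) (x : Fin n → Bool) (g : C.Gate)
    (ih : ∀ h : C.Gate, Sum.inr h ∈ C.preds g → Bool) : {v // v ∈ C.preds g} → Bool
  | ⟨Sum.inl i, _⟩ => x i
  | ⟨Sum.inr h, hh⟩ => ih h hh

/-- The value of an internal gate on the input `x`. -/
def gateVal (C : Circuit n m) (x : Fin n → Bool) : C.Gate → Bool :=
  C.acyclic.fix fun g ih =>
    (C.kind g).output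
      ((C.preds g).attach.filter fun v => C.wireVal x g ih v = true).card
      ((C.preds g).attach.filter fun v => C.wireVal x g ih v = false).card

/-- The value of a vertex (input gate or internal gate) on the input `x`. -/
def val (C : Circuit n m) (x : Fin n → Bool) : Fin n ⊕ C.Gate → Bool :=
  Sum.elim x (C.gateVal x)

/-- The output of the circuit on the input `x`, as a word of length `m`. -/
def eval (C : Circuit n m) (x : Fin n → Bool) : List Bool :=
  List.ofFn fun j => C.val x (C.out j)

/-- The length (number of wires) of a longest path that ends in the given internal gate. -/
def gateDepth (C : Circuit n m) : C.Gate → ℕ :=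
  C.acyclic.fix fun g ih =>
    (C.preds g).attach.sup fun v =>
      match v with
      | ⟨Sum.inl _, _⟩ => 1
      | ⟨Sum.inr h, hh⟩ => ih h hh + 1

/-- The depth of the circuit: the length of a longest path. -/
def depth (C : Circuit n m) : ℕ :=
  letI := C.fintypeGate
  Finset.univ.sup C.gateDepth

/-- The size of the circuit: the number of its vertices. -/
def size (C : Circuit n m) : ℕ :=
  letI := C.fintypeGate
  Fintype.card (Fin n ⊕ C.Gate)

theorem gateVal_eq (C : Circuit n m) (x : Fin n → Bool) (g : C.Gate) :
    C.gateVal x g = (C.kind g).output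
      ((C.preds g).filter fun v => C.val x v = true).card
      ((C.preds g).filter fun v => C.val x v = false).card := by
  have key : ∀ b : Bool,
      ((C.preds g).attach.filter fun v : {v // v ∈ C.preds g} => C.val x v.1 = b).card
        = ((C.preds g).filter fun v => C.val x v = b).card := by
    intro b
    rw [Finset.filter_attach (fun v => C.val x v = b), Finset.card_map, Finset.card_attach]
  rw [← key, ← key]
  conv_lhs => unfold gateVal
  rw [WellFounded.fix_eq]
  refine congrArg₂ _ (congrArg _ ?_) (congrArg _ ?_) <;>
  · apply Finset.filter_congr
    rintro ⟨v | v, hv⟩ _ <;> rfl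

theorem gateDepth_eq (C : Circuit n m) (g : C.Gate) :
    C.gateDepth g = (C.preds g).sup (Sum.elim (fun _ => 1) fun h => C.gateDepth h + 1) := by
  rw [← Finset.sup_attach (C.preds g)]
  conv_lhs => unfold gateDepth
  rw [WellFounded.fix_eq]
  apply Finset.sup_congr rfl
  rintro ⟨v | v, hv⟩ _ <;> rfl

end Circuit

/-- Membership of a computational problem in (non-uniform) `TC⁰`. The problem has the set `X` of
admissible inputs, where `x : X` is given as the binary word `enc x`, and asks for the binary word
`f x`. It is in `TC⁰` if there is a family of circuits `C n`, one for each input length `n`, of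
polynomial size and constant depth such that, for every admissible input `x`, the circuit for the
length of `enc x` outputs `f x` on `enc x`. -/
def InTC0 {X : Type*} (enc : X → List Bool) (f : X → List Bool) : Prop :=
  ∃ (m : ℕ → ℕ) (C : ∀ n : ℕ, Circuit n (m n)) (p : Polynomial ℕ) (d : ℕ),
    (∀ n : ℕ, (C n).size ≤ p.eval n ∧ (C n).depth ≤ d) ∧
    ∀ x : X, (C (enc x).length).eval (enc x).get = f x

end TC

/-! ## Power circuits -/

namespace PC

/-- The interval of integers `[-q+1 .. q-1]`. -/
abbrev Digit (q : ℕ) : Type := Set.Icc (-(q : ℤ) + 1) ((q : ℤ) - 1)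

/-- A marking on the node set `V`. -/
abbrev Marking (q : ℕ) (V : Type*) : Type _ := V → Digit q

/-- A pair `(V, δ)` with `δ : V × V → [-q+1 .. q-1]` such that the graph with vertex set `V` and
edge set the support of `δ` is acyclic (for finite `V`, this is well-foundedness). The successor
marking of the node `P` is `δ P`. -/
structure LabelledDag (q : ℕ) (V : Type*) where
  δ : V → Marking q V
  acyclic : WellFounded fun Q P : V => (δ P Q : ℤ) ≠ 0

namespace LabelledDag

variable {q : ℕ} {V : Type*} [Fintype V]

/-- The evaluation `ε(P) = q ^ ε(Λ_P)` of a node `P`, where `Λ_P = δ P`, by recursion along the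
dag. -/
noncomputable def nodeEval (G : LabelledDag q V) : V → ℝ :=
  G.acyclic.fix fun P ih =>
    (q : ℝ) ^ (∑ Q : V, if h : (G.δ P Q : ℤ) ≠ 0 then ((G.δ P Q : ℤ) : ℝ) * ih Q h else 0 : ℝ)

/-- The evaluation `ε(M) = ∑ M(P) ε(P)` of a marking `M`. -/
noncomputable def markingEval (G : LabelledDag q V) (M : Marking q V) : ℝ :=
  ∑ P : V, ((M P : ℤ) : ℝ) * G.nodeEval P

theorem nodeEval_eq (G : LabelledDag q V) (P : V) :
    G.nodeEval P = (q : ℝ) ^ G.markingEval (G.δ P) := by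
  conv_lhs => unfold nodeEval
  rw [WellFounded.fix_eq]
  unfold markingEval
  congr 1
  apply Finset.sum_congr rfl
  intro Q _
  by_cases h : (G.δ P Q : ℤ) = 0
  · simp [h]
  · rw [dif_pos h]
    rfl

/-- Compact markings. -/
def CompactMarking (G : LabelledDag q V) (M : Marking q V) : Prop :=
  ∀ P Q : V, (M P : ℤ) ≠ 0 → (M Q : ℤ) ≠ 0 → P ≠ Q →
    G.nodeEval P ≠ G.nodeEval Q ∧
    ((|(M P : ℤ)| = (q : ℤ) - 1 ∧ |(M Q : ℤ)| = (q : ℤ) - 1) ∨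
        (M P : ℤ).sign ≠ (M Q : ℤ).sign →
      2 ≤ |G.markingEval (G.δ P) - G.markingEval (G.δ Q)|)

end LabelledDag

/-- A base-`q` power circuit with node set `V`: every node evaluates to an integer in `q ^ ℕ`. -/
structure PowerCircuit (q : ℕ) (V : Type*) [Fintype V] extends LabelledDag q V where
  nodeEval_mem : ∀ P : V, ∃ e : ℕ, toLabelledDag.nodeEval P = (q : ℝ) ^ e

/-- The evaluation of a marking on a power circuit, as an integer. -/
noncomputable def PowerCircuit.intEval {q : ℕ} {V : Type*} [Fintype V] (Γ : PowerCircuit q V)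
    (M : Marking q V) : ℤ :=
  ⌊Γ.markingEval M⌋

/-- On a power circuit all markings evaluate to integers, so no rounding takes place. -/
theorem PowerCircuit.intEval_cast {q : ℕ} {V : Type*} [Fintype V] (Γ : PowerCircuit q V)
    (M : Marking q V) : (Γ.intEval M : ℝ) = Γ.markingEval M := by
  choose e he using Γ.nodeEval_mem
  have h : Γ.markingEval M = ((∑ P : V, (M P : ℤ) * (q : ℤ) ^ e P : ℤ) : ℝ) := by
    unfold LabelledDag.markingEval
    push_cast
    exact Finset.sum_congr rfl fun P _ => by rw [he P]
  unfold PowerCircuit.intEval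
  rw [h, Int.floor_intCast]

/-- A reduced base-`q` power circuit with the sorted list of nodes `P_0, …, P_{n-1}`. -/
structure ReducedPowerCircuit (q n : ℕ) extends PowerCircuit q (Fin n) where
  compact : ∀ P : Fin n, toPowerCircuit.CompactMarking (toPowerCircuit.δ P)
  sorted : StrictMono toPowerCircuit.nodeEval

/-- A reduced base-`q` power circuit together with a compact marking on it. -/
structure MarkedCircuit (q : ℕ) where
  n : ℕ
  Γ : ReducedPowerCircuit q n
  M : Marking q (Fin n)
  compact : Γ.CompactMarking M

/-- A digit is written as a sign bit followed by the binary notation of its absolute value (least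
significant bit first), padded to the bit length of `q - 1`. -/
def encodeDigit (q : ℕ) (a : Digit q) : List Bool :=
  decide ((a : ℤ) < 0) :: List.ofFn fun i : Fin (Nat.size (q - 1)) => (a : ℤ).natAbs.testBit i

/-- A marking on `P_0, …, P_{n-1}` is written as the sequence of its `n` digits. -/
def encodeMarking (q : ℕ) {n : ℕ} (M : Marking q (Fin n)) : List Bool :=
  (List.ofFn M).flatMap (encodeDigit q)

/-- The input word: the `n × n` matrix of `δ`, row by row, followed by the marking. -/
def MarkedCircuit.encode {q : ℕ} (I : MarkedCircuit q) : List Bool :=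
  (List.ofFn fun P : Fin I.n => encodeMarking q (I.Γ.δ P)).flatten ++ encodeMarking q I.M

end PC

/-!
In a power circuit every node `P` has `ε(P) = q ^ e(P)`, where the exponent `e(P)` is a natural
number, namely the evaluation of the successor marking: `e(P) = ∑ Q, δ(P, Q) * q ^ e(Q)`. The
theorem holds because the residue of `ε(M)` modulo `k` is reached from the input by a number of
rounds of iterated addition modulo constants that depends on `q` and `k` only.

Modulo `k`, the powers of `q` become periodic, with a period `l < k` (`PC.exists_period_lt`). Hence
`ε(P) mod k` is determined by `e(P) mod l` together with the exact value of `e(P)` if this is below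
some constant `t`. As `e(P)` is itself the evaluation of a marking, `e(P) mod l` is a sum of
residues of node evaluations modulo `l`, and one recurses from `k` to `l < k`
(`PC.definableFun_nodeEval_mod`).

It remains to decide `e(P) = a` for a constant `a`. Here the compactness of the successor markings
enters: the terms whose sign is opposite to that of the leading one have exponents at least `2`
below it, so every `Q` in the support of a compact marking `M` has `e(Q) < |ε(M)|`
(`PC.PowerCircuit.exponent_lt_abs_sum`). Therefore `e(P) = a` forces all successors of `P` to have
exponents below `a`, in which case `e(P) < q ^ a`, so that it suffices to know `e(P)` modulo `q ^ a`
(`PC.PowerCircuit.exponent_eq_iff`). This gives a recursion over the numbers below `a`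
(`PC.definable_exponent_eq`).

On the side of circuits, it is convenient to work with formulas in negations and majorities, since
for constant depth the passage from a circuit to a formula costs only a polynomial factor. A family
of predicates is `TC.Definable` if it is given by formulas of bounded height and polynomial size;
such families are closed under Boolean operations, quantifiers over `Fin n` and thresholds, and
iterated addition modulo a constant is obtained by counting the terms with a given residue
(`TC.DefinableFun.sum_fin`). The vertices of the formula trees are the gates of the final circuits
(`TC.Formula.exists_circuit`).
-/

/-! ### Majority formulas and their circuits -/

namespace TC

/-- Boolean formulas over the variables `x_0, x_1, …`, built from negations and majorities of
finitely many formulas. -/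
inductive Formula where
  | var (i : ℕ)
  | neg (F : Formula)
  | maj (m : ℕ) (f : Fin m → Formula)

namespace Formula

/-- The truth value under an assignment. A majority is strict: a tie counts as `false`. -/
def eval (x : ℕ → Bool) : Formula → Bool
  | var i => x i
  | neg F => !F.eval x
  | maj m f => decide (m < 2 * ∑ i, ((f i).eval x).toNat)

/-- The height of the formula tree; a variable has height `1`, as it becomes a gate of its own. -/
def height : Formula → ℕ
  | var _ => 1
  | neg F => F.height + 1
  | maj _ f => (Finset.univ.sup fun i => (f i).height) + 1

/-- The number of vertices of the formula tree. -/
def size : Formula → ℕ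
  | var _ => 1
  | neg F => F.size + 1
  | maj _ f => (∑ i, (f i).size) + 1

/-- The vertices of the formula tree. Distinct occurrences of a subformula are distinct vertices,
so that the set of children of a majority loses no multiplicities. -/
def Vertex : Formula → Type
  | var _ => Unit
  | neg F => Option F.Vertex
  | maj _ f => Option (Σ i, (f i).Vertex)

/-- The root of the formula tree. -/
def root : ∀ F : Formula, F.Vertex
  | var _ => ()
  | neg _ => none
  | maj _ _ => none

/-- The formula tree is finite. -/
@[reducible]
def fintypeVertex : ∀ F : Formula, Fintype F.Vertex
  | var _ => inferInstanceAs (Fintype Unit)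
  | neg F => letI := F.fintypeVertex; inferInstanceAs (Fintype (Option F.Vertex))
  | maj _ f =>
    letI := fun i => (f i).fintypeVertex
    inferInstanceAs (Fintype (Option (Σ i, (f i).Vertex)))

theorem card_vertex : ∀ F : Formula, @Fintype.card F.Vertex F.fintypeVertex = F.size
  | var _ => rfl
  | neg F => by
    let := F.fintypeVertex
    have h : Fintype.card (Option F.Vertex) = F.size + 1 := by
      rw [Fintype.card_option, card_vertex F]
    exact h
  | maj m f => by
    let := fun i => (f i).fintypeVertex
    have h : Fintype.card (Option (Σ i, (f i).Vertex)) = (∑ i, (f i).size) + 1 := by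
      rw [Fintype.card_option, Fintype.card_sigma]
      exact congrArg (· + 1) (Finset.sum_congr rfl fun i _ => card_vertex (f i))
    exact h

/-- The gate type of a vertex. Variables become unary `or` gates. -/
def kind : ∀ F : Formula, F.Vertex → GateKind
  | var _, _ => .or
  | neg _, none => .not
  | neg F, some v => F.kind v
  | maj _ _, none => .majority
  | maj _ f, some ⟨i, v⟩ => (f i).kind v

/-- A vertex of `F` as a vertex of `neg F`. -/
def negVertex (F : Formula) (v : F.Vertex) : (neg F).Vertex := some v

/-- A vertex of `f i` as a vertex of `maj m f`. -/
def majVertex {m : ℕ} (f : Fin m → Formula) (i : Fin m) (v : (f i).Vertex) :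
    (maj m f).Vertex := some ⟨i, v⟩

/-- The inclusion of the vertices of `F` into those of `neg F`, extended by the inputs. -/
def negEmb (N : ℕ) (F : Formula) : Fin N ⊕ F.Vertex ↪ Fin N ⊕ (neg F).Vertex :=
  Function.Embedding.sumMap (.refl _) ⟨negVertex F, Option.some_injective _⟩

/-- The inclusion of the vertices of `f i` into those of `maj m f`, extended by the inputs. -/
def majEmb (N : ℕ) {m : ℕ} (f : Fin m → Formula) (i : Fin m) :
    Fin N ⊕ (f i).Vertex ↪ Fin N ⊕ (maj m f).Vertex :=
  Function.Embedding.sumMap (.refl _)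
    ⟨majVertex f i, (Option.some_injective _).comp sigma_mk_injective⟩

/-- The children of the root of `maj m f`. -/
def childEmb (N : ℕ) {m : ℕ} (f : Fin m → Formula) : Fin m ↪ Fin N ⊕ (maj m f).Vertex :=
  ⟨fun i => Sum.inr (majVertex f i (f i).root), fun i j h => by
    have h' := Option.some_injective _ (Sum.inr_injective h)
    exact congrArg Sigma.fst h'⟩

/-- The vertices that feed a given vertex of the circuit with `N` inputs. A variable beyond the
inputs has no predecessor, so that its `or` gate is constantly `false`. -/
def preds (N : ℕ) : ∀ F : Formula, F.Vertex → Finset (Fin N ⊕ F.Vertex)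
  | var i, _ => if h : i < N then {Sum.inl ⟨i, h⟩} else ∅
  | neg F, none => {Sum.inr (negVertex F F.root)}
  | neg F, some v => (F.preds N v).map (negEmb N F)
  | maj _ f, none => Finset.univ.map (childEmb N f)
  | maj _ f, some ⟨i, v⟩ => ((f i).preds N v).map (majEmb N f i)

/-- The height of the subformula at a vertex. -/
def vertexHeight : ∀ F : Formula, F.Vertex → ℕ
  | var i, _ => (var i).height
  | neg F, none => (neg F).height
  | neg F, some v => F.vertexHeight v
  | maj m f, none => (maj m f).height
  | maj _ f, some ⟨i, v⟩ => (f i).vertexHeight v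

/-- The truth value of the subformula at a vertex. -/
def vertexVal (x : ℕ → Bool) : ∀ F : Formula, F.Vertex → Bool
  | var i, _ => x i
  | neg F, none => (neg F).eval x
  | neg F, some v => F.vertexVal x v
  | maj m f, none => (maj m f).eval x
  | maj _ f, some ⟨i, v⟩ => (f i).vertexVal x v

theorem vertexHeight_root : ∀ F : Formula, F.vertexHeight F.root = F.height
  | var _ => rfl
  | neg _ => rfl
  | maj _ _ => rfl

theorem vertexVal_root (x : ℕ → Bool) : ∀ F : Formula, F.vertexVal x F.root = F.eval x
  | var _ => rfl
  | neg _ => rfl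
  | maj _ _ => rfl

theorem one_le_height : ∀ F : Formula, 1 ≤ F.height
  | var _ => le_rfl
  | neg _ => Nat.le_add_left _ _
  | maj _ _ => Nat.le_add_left _ _

theorem one_le_vertexHeight : ∀ (F : Formula) (v : F.Vertex), 1 ≤ F.vertexHeight v
  | var _, _ => le_rfl
  | neg F, none => (neg F).one_le_height
  | neg F, some v => F.one_le_vertexHeight v
  | maj m f, none => (maj m f).one_le_height
  | maj _ f, some ⟨i, v⟩ => (f i).one_le_vertexHeight v

theorem vertexHeight_le : ∀ (F : Formula) (v : F.Vertex), F.vertexHeight v ≤ F.height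
  | var _, _ => le_rfl
  | neg _, none => le_rfl
  | neg F, some v => (F.vertexHeight_le v).trans (Nat.le_succ _)
  | maj _ _, none => le_rfl
  | maj _ f, some ⟨i, v⟩ => ((f i).vertexHeight_le v).trans
      ((Finset.le_sup (f := fun i => (f i).height) (Finset.mem_univ i)).trans (Nat.le_succ _))

theorem vertexHeight_lt (N : ℕ) : ∀ (F : Formula) (v u : F.Vertex),
    Sum.inr u ∈ F.preds N v → F.vertexHeight u < F.vertexHeight v
  | var i, v, u, h => by
    unfold preds at h
    split_ifs at h <;> simp at h
  | neg F, none, u, h => by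
    have h' : u = negVertex F F.root := Sum.inr_injective (Finset.mem_singleton.1 h)
    subst h'
    exact (F.vertexHeight_root).trans_lt (Nat.lt_succ_self _)
  | neg F, some v, u, h => by
    obtain ⟨z, hz, hzu⟩ := Finset.mem_map.1 h
    rcases z with z | z
    · exact absurd hzu (by simp [negEmb])
    · have h' : negVertex F z = u := Sum.inr_injective hzu
      subst h'
      exact F.vertexHeight_lt N v z hz
  | maj m f, none, u, h => by
    obtain ⟨i, _, hi⟩ := Finset.mem_map.1 h
    have h' : majVertex f i (f i).root = u := Sum.inr_injective hi
    subst h'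
    exact ((f i).vertexHeight_root).trans_lt (Nat.lt_succ_of_le
      (Finset.le_sup (f := fun i => (f i).height) (Finset.mem_univ i)))
  | maj m f, some ⟨i, v⟩, u, h => by
    obtain ⟨z, hz, hzu⟩ := Finset.mem_map.1 h
    rcases z with z | z
    · exact absurd hzu (by simp [majEmb])
    · have h' : majVertex f i z = u := Sum.inr_injective hzu
      subst h'
      exact (f i).vertexHeight_lt N v z hz

/-- The assignment given by an input word, extended by `false`. -/
def extend {N : ℕ} (x : Fin N → Bool) (i : ℕ) : Bool :=
  if h : i < N then x ⟨i, h⟩ else false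

/-- The truth values at the vertices satisfy the gate equations of the circuit. -/
theorem vertexVal_eq {N : ℕ} (x : Fin N → Bool) : ∀ (F : Formula) (v : F.Vertex),
    F.vertexVal (extend x) v = (F.kind v).output
      ((F.preds N v).filter fun u => Sum.elim x (F.vertexVal (extend x)) u = true).card
      ((F.preds N v).filter fun u => Sum.elim x (F.vertexVal (extend x)) u = false).card
  | var i, v => by
    change extend x i = decide (_ ≠ 0)
    unfold preds extend
    split_ifs with h
    · rw [Finset.filter_singleton]
      cases hx : x ⟨i, h⟩ <;> simp [hx]
    · simp
  | neg F, none => by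
    change (neg F).eval (extend x) = decide (_ = 0)
    have h : (neg F).preds N none = {Sum.inr (negVertex F F.root)} := rfl
    have h2 : (neg F).vertexVal (extend x) (negVertex F F.root) = F.eval (extend x) :=
      F.vertexVal_root _
    rw [h, Finset.filter_singleton, Sum.elim_inr, h2]
    cases hx : F.eval (extend x) <;> simp [eval, hx]
  | neg F, some v => by
    have h : (neg F).preds N (some v) = (F.preds N v).map (negEmb N F) := rfl
    have h2 : ∀ u, Sum.elim x ((neg F).vertexVal (extend x)) (negEmb N F u) =
        Sum.elim x (F.vertexVal (extend x)) u := by rintro (u | u) <;> rfl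
    rw [h, Finset.filter_map, Finset.card_map, Finset.filter_map, Finset.card_map]
    simp only [Function.comp_def, h2]
    exact F.vertexVal_eq x v
  | maj m f, none => by
    have h : (maj m f).preds N none = Finset.univ.map (childEmb N f) := rfl
    have h2 : ∀ i, Sum.elim x ((maj m f).vertexVal (extend x)) (childEmb N f i) =
        (f i).eval (extend x) := fun i => (f i).vertexVal_root _
    rw [h, Finset.filter_map, Finset.card_map, Finset.filter_map, Finset.card_map]
    simp only [Function.comp_def, h2]
    change decide _ = decide _
    have h3 : ∑ i, ((f i).eval (extend x)).toNat =
        (Finset.univ.filter fun i => (f i).eval (extend x) = true).card := by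
      rw [Finset.card_filter]
      refine Finset.sum_congr rfl fun i _ => ?_
      cases (f i).eval (extend x) <;> rfl
    have h4 := Finset.card_filter_add_card_filter_not (s := (Finset.univ : Finset (Fin m)))
      fun i => (f i).eval (extend x) = true
    simp only [Bool.not_eq_true, Finset.card_univ, Fintype.card_fin] at h4
    rw [h3]
    apply decide_eq_decide.2
    omega
  | maj m f, some ⟨i, v⟩ => by
    have h : (maj m f).preds N (some ⟨i, v⟩) = ((f i).preds N v).map (majEmb N f i) := rfl
    have h2 : ∀ u, Sum.elim x ((maj m f).vertexVal (extend x)) (majEmb N f i u) =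
        Sum.elim x ((f i).vertexVal (extend x)) u := by rintro (u | u) <;> rfl
    rw [h, Finset.filter_map, Finset.card_map, Finset.filter_map, Finset.card_map]
    simp only [Function.comp_def, h2]
    exact (f i).vertexVal_eq x v

theorem card_preds_of_not (N : ℕ) : ∀ (F : Formula) (v : F.Vertex),
    F.kind v = .not → (F.preds N v).card = 1
  | var _, _, h => by cases h
  | neg F, none, _ => rfl
  | neg F, some v, h => (Finset.card_map _).trans (F.card_preds_of_not N v h)
  | maj m f, none, h => by cases h
  | maj _ f, some ⟨i, v⟩, h => (Finset.card_map _).trans ((f i).card_preds_of_not N v h)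

/-- The circuit of the formula tree, with the output gates at given vertices. -/
def toCircuit (N : ℕ) {m : ℕ} (F : Formula) (out : Fin m → F.Vertex) : Circuit N m where
  Gate := F.Vertex
  fintypeGate := F.fintypeVertex
  kind := F.kind
  preds := F.preds N
  card_preds_of_not := F.card_preds_of_not N
  acyclic := Subrelation.wf (fun {u v} h => F.vertexHeight_lt N v u h)
    (InvImage.wf F.vertexHeight Nat.lt_wfRel.wf)
  out j := Sum.inr (out j)

variable {N m : ℕ} (F : Formula) (out : Fin m → F.Vertex)

theorem gateVal_toCircuit (x : Fin N → Bool) (v : F.Vertex) :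
    (F.toCircuit N out).gateVal x v = F.vertexVal (extend x) v := by
  induction v using (F.toCircuit N out).acyclic.induction with
  | _ v ih =>
    refine ((F.toCircuit N out).gateVal_eq x v).trans (Eq.trans ?_ (F.vertexVal_eq x v).symm)
    have h : ∀ u ∈ F.preds N v, (F.toCircuit N out).val x u =
        Sum.elim x (F.vertexVal (extend x)) u := by
      rintro (u | u) hu
      · rfl
      · exact ih u hu
    let val₁ : Fin N ⊕ F.Vertex → Bool := (F.toCircuit N out).val x
    let val₂ : Fin N ⊕ F.Vertex → Bool := Sum.elim x (F.vertexVal (extend x))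
    have h2 (b : Bool) : ((F.preds N v).filter fun u => val₁ u = b) =
        (F.preds N v).filter fun u => val₂ u = b :=
      Finset.filter_congr fun u hu => by rw [show val₁ u = val₂ u from h u hu]
    exact congrArg₂ _ (congrArg _ (h2 true)) (congrArg _ (h2 false))

theorem gateDepth_toCircuit (v : F.Vertex) :
    (F.toCircuit N out).gateDepth v ≤ F.vertexHeight v := by
  induction v using (F.toCircuit N out).acyclic.induction with
  | _ v ih =>
    refine ((F.toCircuit N out).gateDepth_eq v).trans_le (Finset.sup_le ?_)
    rintro (u | u) hu
    · exact F.one_le_vertexHeight v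
    · exact (Nat.succ_le_succ (ih u hu)).trans (F.vertexHeight_lt N v u hu)

theorem depth_toCircuit_le : (F.toCircuit N out).depth ≤ F.height :=
  Finset.sup_le fun v _ => (F.gateDepth_toCircuit out v).trans (F.vertexHeight_le v)

theorem size_toCircuit : (F.toCircuit N out).size = N + F.size := by
  let := F.fintypeVertex
  have h : Fintype.card (Fin N ⊕ F.Vertex) = N + F.size := by
    rw [Fintype.card_sum, Fintype.card_fin, F.card_vertex]
  exact h

/-- Finitely many formulas are computed by one circuit, which shares nothing between them. -/
theorem exists_circuit (N m : ℕ) (f : Fin m → Formula) :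
    ∃ C : Circuit N m, C.size = N + (maj m f).size ∧ C.depth ≤ (maj m f).height ∧
      ∀ x, C.eval x = List.ofFn fun j => (f j).eval (extend x) := by
  refine ⟨(maj m f).toCircuit N fun j => some ⟨j, (f j).root⟩, size_toCircuit _ _,
    depth_toCircuit_le _ _, fun x => ?_⟩
  refine congrArg List.ofFn (funext fun j => ?_)
  exact (gateVal_toCircuit _ _ x _).trans ((f j).vertexVal_root _)

end Formula

end TC

/-! ### Definable families -/

namespace TC

open Formula

/-- A family of predicates on inputs `X n`, indexed by `J n`, is definable if it is given by
formulas of bounded height and of size polynomial in `n` (written as `(n + 2) ^ c`) in the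
input bits. The formulas may depend on the index in an arbitrary way; only the bounds are uniform.
No condition is imposed on assignments that do not come from an input. -/
def Definable {X : ℕ → Type*} (bits : ∀ n, X n → ℕ → Bool) {J : ℕ → Type*}
    (φ : ∀ n, J n → X n → Prop) : Prop :=
  ∃ c : ℕ, ∀ n (j : J n), ∃ F : Formula, F.height ≤ c ∧ F.size ≤ (n + 2) ^ c ∧
    ∀ x, F.eval (bits n x) = true ↔ φ n j x

/-- A family of functions is definable if all its fibres are. This is the right notion for finite
codomains. -/
def DefinableFun {X : ℕ → Type*} (bits : ∀ n, X n → ℕ → Bool) {J : ℕ → Type*} {α : Type*}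
    (g : ∀ n, J n → X n → α) : Prop :=
  ∀ a, Definable bits fun n j x => g n j x = a

variable {X : ℕ → Type*} {bits : ∀ n, X n → ℕ → Bool} {J J' : ℕ → Type*}

theorem Definable.congr {φ ψ : ∀ n, J n → X n → Prop} (h : Definable bits φ)
    (hφψ : ∀ n j x, φ n j x ↔ ψ n j x) : Definable bits ψ := by
  obtain ⟨c, h⟩ := h
  refine ⟨c, fun n j => ?_⟩
  obtain ⟨F, h1, h2, h3⟩ := h n j
  exact ⟨F, h1, h2, fun x => (h3 x).trans (hφψ n j x)⟩

theorem Definable.reindex {φ : ∀ n, J n → X n → Prop} (h : Definable bits φ)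
    (σ : ∀ n, J' n → J n) : Definable bits fun n j x => φ n (σ n j) x := by
  obtain ⟨c, h⟩ := h
  exact ⟨c, fun n j => h n (σ n j)⟩

theorem definable_bit (i : ∀ n, J n → ℕ) :
    Definable bits fun n j x => bits n x (i n j) = true :=
  ⟨1, fun n j => ⟨.var (i n j), le_rfl, by simp [size], fun _ => Iff.rfl⟩⟩

theorem Definable.not {φ : ∀ n, J n → X n → Prop} (h : Definable bits φ) :
    Definable bits fun n j x => ¬ φ n j x := by
  obtain ⟨c, h⟩ := h
  refine ⟨c + 1, fun n j => ?_⟩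
  obtain ⟨F, h1, h2, h3⟩ := h n j
  refine ⟨.neg F, Nat.succ_le_succ h1, ?_, fun x => by simp [eval, ← h3]⟩
  have := Nat.one_le_pow c (n + 2) (by omega)
  calc F.size + 1 ≤ (n + 2) ^ c * 2 := by omega
    _ ≤ (n + 2) ^ (c + 1) := by rw [pow_succ]; gcongr; omega

/-- A formula that is constantly `false`: the empty majority is a tie. -/
def Formula.bot : Formula := .maj 0 Fin.elim0

/-- The threshold formula `#{i | f i} ≥ t`: a majority of the `f i` together with `n + 1` constants
`true` and `2 t` constants `false`. -/
def Formula.threshold (t : ℕ) {n : ℕ} (f : Fin n → Formula) : Formula :=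
  .maj (n + ((n + 1) + 2 * t)) (Fin.append f (Fin.append (fun _ => .neg .bot) fun _ => .bot))

theorem Formula.eval_threshold (x : ℕ → Bool) (t : ℕ) {n : ℕ} (f : Fin n → Formula) :
    (threshold t f).eval x = true ↔ t ≤ (Finset.univ.filter fun i => (f i).eval x = true).card := by
  have h : ∑ i, ((f i).eval x).toNat =
      (Finset.univ.filter fun i => (f i).eval x = true).card := by
    rw [Finset.card_filter]
    refine Finset.sum_congr rfl fun i _ => ?_
    cases (f i).eval x <;> rfl
  have h1 : bot.eval x = false := rfl
  have h2 : (neg bot).eval x = true := rfl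
  simp only [threshold, eval.eq_3, Fin.sum_univ_add, Fin.append_left, Fin.append_right, h1, h2, h,
    decide_eq_true_eq, Finset.sum_const, Finset.card_univ, Fintype.card_fin, Bool.toNat_true,
    Bool.toNat_false, smul_eq_mul]
  omega

theorem Formula.size_threshold (t : ℕ) {n : ℕ} (f : Fin n → Formula) :
    (threshold t f).size = ∑ i, (f i).size + 2 * (n + 1) + 2 * t + 1 := by
  have h1 : bot.size = 1 := rfl
  have h2 : (neg bot).size = 2 := rfl
  simp only [threshold, size.eq_3, Fin.sum_univ_add, Fin.append_left, Fin.append_right, h1, h2,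
    Finset.sum_const, Finset.card_univ, Fintype.card_fin, smul_eq_mul]
  omega

theorem Formula.height_threshold_le (t : ℕ) {n : ℕ} (f : Fin n → Formula) {c : ℕ}
    (h : ∀ i, (f i).height ≤ c) : (threshold t f).height ≤ c + 3 := by
  refine Nat.succ_le_succ (Finset.sup_le fun i _ => ?_)
  have h1 : bot.height = 1 := rfl
  have h2 : (neg bot).height = 2 := rfl
  refine Fin.addCases (fun i => ?_) (fun i => ?_) i
  · rw [Fin.append_left]; exact (h i).trans (by omega)
  · rw [Fin.append_right]
    refine Fin.addCases (fun i => ?_) (fun i => ?_) i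
    · rw [Fin.append_left, h2]; omega
    · rw [Fin.append_right, h1]; omega

theorem Definable.threshold {φ : ∀ n, J n × Fin n → X n → Prop} (h : Definable bits φ)
    (t : ∀ n, J n → ℕ) :
    Definable bits fun n j x => t n j ≤ Nat.card {i : Fin n // φ n (j, i) x} := by
  obtain ⟨c, h⟩ := h
  refine ⟨c + 4, fun n j => ?_⟩
  choose F h1 h2 h3 using fun i => h n (j, i)
  -- Capping the threshold at `n + 1` keeps the padding small and does not change the predicate.
  refine ⟨.threshold (min (t n j) (n + 1)) F,
    (height_threshold_le _ F h1).trans (by omega), ?_, fun x => ?_⟩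
  · have hs : ∑ i, (F i).size ≤ n * (n + 2) ^ c := by
      simpa using Finset.sum_le_card_nsmul Finset.univ (fun i => (F i).size) _ fun i _ => h2 i
    have h1 := Nat.one_le_pow c (n + 2) (by omega)
    rw [size_threshold]
    have hm : min (t n j) (n + 1) ≤ n + 1 := min_le_right _ _
    calc _ ≤ n * (n + 2) ^ c + (4 * n + 5) * 1 := by omega
      _ ≤ n * (n + 2) ^ c + (4 * n + 5) * (n + 2) ^ c := by gcongr
      _ = (n + 2) ^ c * (5 * n + 5) := by ring
      _ ≤ (n + 2) ^ c * (n + 2) ^ 4 := by gcongr; ring_nf; nlinarith [sq_nonneg n]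
      _ = (n + 2) ^ (c + 4) := (pow_add _ _ _).symm
  · have hc : Nat.card {i : Fin n // φ n (j, i) x} =
        (Finset.univ.filter fun i => (F i).eval (bits n x) = true).card := by
      rw [← Fintype.card_subtype, ← Nat.card_eq_fintype_card]
      exact Nat.card_congr (Equiv.subtypeEquivRight fun i => (h3 i x).symm)
    have hn : (Finset.univ.filter fun i => (F i).eval (bits n x) = true).card ≤ n :=
      (Finset.card_filter_le _ _).trans (by simp)
    beta_reduce
    rw [eval_threshold, hc]
    omega

theorem Definable.exists_fin {φ : ∀ n, J n × Fin n → X n → Prop} (h : Definable bits φ) :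
    Definable bits fun n j x => ∃ i, φ n (j, i) x :=
  (h.threshold fun _ _ => 1).congr fun n j x => by
    rw [Nat.one_le_iff_ne_zero, Nat.card_ne_zero, nonempty_subtype]
    exact and_iff_left inferInstance

theorem Definable.forall_fin {φ : ∀ n, J n × Fin n → X n → Prop} (h : Definable bits φ) :
    Definable bits fun n j x => ∀ i, φ n (j, i) x :=
  h.not.exists_fin.not.congr fun n j x => by simp

theorem definable_index (p : ∀ n, J n → Prop) :
    Definable bits fun n j _ => p n j := by
  refine ⟨2, fun n j => ?_⟩
  by_cases hp : p n j
  · exact ⟨.neg .bot, le_rfl, Nat.pow_le_pow_left (by omega : 2 ≤ n + 2) 2 |>.trans' (by decide),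
      fun _ => iff_of_true rfl hp⟩
  · exact ⟨.bot, by decide, Nat.one_le_pow _ _ (by omega),
      fun _ => iff_of_false Bool.false_ne_true hp⟩

theorem Definable.or {φ ψ : ∀ n, J n → X n → Prop} (h : Definable bits φ)
    (h' : Definable bits ψ) : Definable bits fun n j x => φ n j x ∨ ψ n j x := by
  obtain ⟨c, h⟩ := h
  obtain ⟨d, h'⟩ := h'
  refine ⟨c + d + 5, fun n j => ?_⟩
  obtain ⟨F, h1, h2, h3⟩ := h n j
  obtain ⟨G, h1', h2', h3'⟩ := h' n j
  refine ⟨.threshold 1 ![F, G], (height_threshold_le (c := c + d) _ _ fun i => ?_).trans (by omega),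
    ?_, fun x => ?_⟩
  · fin_cases i <;> simp <;> omega
  · rw [size_threshold, Fin.sum_univ_two]
    have h4 : (n + 2) ^ c ≤ (n + 2) ^ (c + d) := Nat.pow_le_pow_right (by omega) (by omega)
    have h5 : (n + 2) ^ d ≤ (n + 2) ^ (c + d) := Nat.pow_le_pow_right (by omega) (by omega)
    have h6 := Nat.one_le_pow c (n + 2) (by omega)
    simp only [Matrix.cons_val_zero, Matrix.cons_val_one]
    calc _ ≤ (n + 2) ^ (c + d) * 2 ^ 5 := by omega
      _ ≤ (n + 2) ^ (c + d) * (n + 2) ^ 5 := by gcongr; omega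
      _ = (n + 2) ^ (c + d + 5) := (pow_add _ _ _).symm
  · beta_reduce
    rw [eval_threshold, ← h3, ← h3', Nat.one_le_iff_ne_zero, Finset.card_ne_zero]
    simp [Finset.filter_nonempty_iff, Fin.exists_fin_two]

theorem Definable.and {φ ψ : ∀ n, J n → X n → Prop} (h : Definable bits φ)
    (h' : Definable bits ψ) : Definable bits fun n j x => φ n j x ∧ ψ n j x :=
  (h.not.or h'.not).not.congr fun n j x => by tauto

theorem Definable.exists_finset {ι : Type*} (s : Finset ι) {φ : ι → ∀ n, J n → X n → Prop}
    (h : ∀ a ∈ s, Definable bits (φ a)) : Definable bits fun n j x => ∃ a ∈ s, φ a n j x := by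
  classical
  induction s using Finset.induction_on with
  | empty => exact (definable_index fun _ _ => False).congr fun n j x => by simp
  | insert a s ha ih =>
    exact ((h a (Finset.mem_insert_self _ _)).or
      (ih fun b hb => h b (Finset.mem_insert_of_mem hb))).congr fun n j x => by simp

theorem Definable.exists_finite {ι : Type*} [Finite ι] {φ : ι → ∀ n, J n → X n → Prop}
    (h : ∀ a, Definable bits (φ a)) : Definable bits fun n j x => ∃ a, φ a n j x := by
  have := Fintype.ofFinite ι
  exact (Definable.exists_finset Finset.univ fun a _ => h a).congr fun n j x => by simp

theorem Definable.forall_finite {ι : Type*} [Finite ι] {φ : ι → ∀ n, J n → X n → Prop}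
    (h : ∀ a, Definable bits (φ a)) : Definable bits fun n j x => ∀ a, φ a n j x :=
  (Definable.exists_finite fun a => (h a).not).not.congr fun n j x => by simp

section Fun

variable {α β γ : Type*}

theorem DefinableFun.congr {g g' : ∀ n, J n → X n → α} (h : DefinableFun bits g)
    (hg : ∀ n j x, g n j x = g' n j x) : DefinableFun bits g' :=
  fun a => (h a).congr fun n j x => by rw [hg]

theorem DefinableFun.reindex {g : ∀ n, J n → X n → α} (h : DefinableFun bits g)
    (σ : ∀ n, J' n → J n) : DefinableFun bits fun n j x => g n (σ n j) x :=
  fun a => (h a).reindex σ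

theorem definableFun_const (a : α) : DefinableFun bits fun n (_ : J n) _ => a :=
  fun b => definable_index fun _ _ => a = b

theorem DefinableFun.comp_right [Finite α] {g : ∀ n, J n → X n → α} (h : DefinableFun bits g)
    (u : α → β) : DefinableFun bits fun n j x => u (g n j x) := fun b =>
  (Definable.exists_finite fun a : {a // u a = b} => h a).congr fun n j x => by
    simp

theorem DefinableFun.comp₂ [Finite α] [Finite β] {g : ∀ n, J n → X n → α}
    {g' : ∀ n, J n → X n → β} (h : DefinableFun bits g) (h' : DefinableFun bits g')
    (u : α → β → γ) : DefinableFun bits fun n j x => u (g n j x) (g' n j x) := by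
  have hp : DefinableFun bits fun n j x => (g n j x, g' n j x) := fun p =>
    ((h p.1).and (h' p.2)).congr fun n j x => by rw [Prod.ext_iff]
  exact hp.comp_right fun p => u p.1 p.2

theorem Definable.card_eq {φ : ∀ n, J n × Fin n → X n → Prop} (h : Definable bits φ)
    (t : ∀ n, J n → ℕ) :
    Definable bits fun n j x => Nat.card {i : Fin n // φ n (j, i) x} = t n j :=
  ((h.threshold t).and (h.threshold fun n j => t n j + 1).not).congr fun n j x => by omega

/-- Counting modulo `K`: the residue is read off from the exact count, of which there are only
`n + 1` candidates. -/
theorem Definable.card_mod {φ : ∀ n, J n × Fin n → X n → Prop} (h : Definable bits φ) (K : ℕ) :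
    DefinableFun bits fun n j x => (Nat.card {i : Fin n // φ n (j, i) x} : ZMod K) := by
  intro r
  have hlt : Definable bits fun n (j : J n) x => ∃ c : Fin n,
      Nat.card {i : Fin n // φ n (j, i) x} = c ∧ ((c : ℕ) : ZMod K) = r :=
    Definable.exists_fin (φ := fun n p x =>
      Nat.card {i : Fin n // φ n (p.1, i) x} = p.2 ∧ ((p.2 : ℕ) : ZMod K) = r)
      (((h.reindex (J' := fun n => (J n × Fin n) × Fin n)
        fun n (p : (J n × Fin n) × Fin n) => (p.1.1, p.2)).card_eq
        fun _ (p : J _ × Fin _) => (p.2 : ℕ)).and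
        (definable_index fun n (p : J n × Fin n) => ((p.2 : ℕ) : ZMod K) = r))
  have heq : Definable bits fun n (j : J n) x =>
      Nat.card {i : Fin n // φ n (j, i) x} = n ∧ (n : ZMod K) = r :=
    (h.card_eq fun n _ => n).and (definable_index fun n _ => (n : ZMod K) = r)
  refine (hlt.or heq).congr fun n j x => ⟨?_, fun hr => ?_⟩
  · beta_reduce
    rintro (⟨c, h1, h2⟩ | ⟨h1, h2⟩) <;> rw [h1, h2]
  · have hn : Nat.card {i : Fin n // φ n (j, i) x} ≤ n :=
      (Nat.card_le_card_of_injective _ Subtype.val_injective).trans_eq (Nat.card_fin n)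
    rcases hn.lt_or_eq with hn | hn
    · exact Or.inl ⟨⟨_, hn⟩, rfl, hr⟩
    · exact Or.inr ⟨hn, hn ▸ hr⟩

/-- A sum over an index set that does not depend on the input length. -/
theorem DefinableFun.sum_finset {ι : Type*} {K : ℕ} [NeZero K] (s : Finset ι)
    {g : ι → ∀ n, J n → X n → ZMod K} (h : ∀ a, DefinableFun bits (g a)) :
    DefinableFun bits fun n j x => ∑ a ∈ s, g a n j x := by
  classical
  induction s using Finset.induction_on with
  | empty => exact (definableFun_const 0).congr fun n j x => by simp
  | insert a s ha ih =>
    exact ((h a).comp₂ ih (· + ·)).congr fun n j x => by rw [Finset.sum_insert ha]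

/-- Iterated addition modulo a constant: the terms are counted according to their residue. -/
theorem DefinableFun.sum_fin {K : ℕ} [NeZero K] {g : ∀ n, J n × Fin n → X n → ZMod K}
    (h : DefinableFun bits g) : DefinableFun bits fun n j x => ∑ i, g n (j, i) x := by
  refine (DefinableFun.sum_finset (Finset.univ : Finset (ZMod K)) fun a =>
    ((h a).card_mod K).comp_right fun r => r * a).congr fun n j x => ?_
  rw [← Finset.sum_fiberwise Finset.univ fun i => g n (j, i) x]
  refine Finset.sum_congr rfl fun a _ => ?_
  rw [Finset.sum_congr rfl fun i hi => (Finset.mem_filter.1 hi).2, Finset.sum_const, nsmul_eq_mul,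
    Nat.card_eq_fintype_card, Fintype.card_subtype]

end Fun

end TC

/-! ### Sums of powers with signed digits -/

namespace PC

/-- A sum of distinct powers `q ^ e` with `e < a` and digits at most `q - 1` in absolute value is
smaller than `q ^ a`. -/
theorem abs_sum_digit_mul_pow_lt {ι : Type*} {q : ℕ} (hq : 1 ≤ q) (s : Finset ι) (d : ι → ℤ)
    (e : ι → ℕ) (a : ℕ) (he : Set.InjOn e s) (hea : ∀ i ∈ s, e i < a)
    (hd : ∀ i ∈ s, |d i| ≤ (q : ℤ) - 1) : |∑ i ∈ s, d i * (q : ℤ) ^ e i| < (q : ℤ) ^ a := by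
  have hq' : (0 : ℤ) ≤ (q : ℤ) - 1 := by omega
  calc |∑ i ∈ s, d i * (q : ℤ) ^ e i| ≤ ∑ i ∈ s, |d i * (q : ℤ) ^ e i| :=
        Finset.abs_sum_le_sum_abs _ _
    _ ≤ ∑ i ∈ s, ((q : ℤ) - 1) * (q : ℤ) ^ e i := by
        refine Finset.sum_le_sum fun i hi => ?_
        rw [abs_mul, abs_of_nonneg (by positivity : (0 : ℤ) ≤ (q : ℤ) ^ e i)]
        exact mul_le_mul_of_nonneg_right (hd i hi) (by positivity)
    _ = ∑ j ∈ s.image e, ((q : ℤ) - 1) * (q : ℤ) ^ j := by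
        rw [Finset.sum_image he]
    _ ≤ ∑ j ∈ Finset.range a, ((q : ℤ) - 1) * (q : ℤ) ^ j := by
        refine Finset.sum_le_sum_of_subset_of_nonneg (fun j hj => ?_) fun j _ _ => by positivity
        obtain ⟨i, hi, rfl⟩ := Finset.mem_image.1 hj
        exact Finset.mem_range.2 (hea i hi)
    _ = (q : ℤ) ^ a - 1 := by rw [← Finset.mul_sum, mul_geom_sum]
    _ < (q : ℤ) ^ a := by omega

/-- If the leading digit is positive, the leading power outweighs the negative terms, as their
exponents stay at least `2` below the leading one. -/
theorem lt_sum_digit_mul_pow {ι : Type*} [Fintype ι] {q : ℕ} (hq : 2 ≤ q) (d : ι → ℤ) (e : ι → ℕ)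
    (hd : ∀ i, |d i| ≤ (q : ℤ) - 1)
    (he : ∀ i j, d i ≠ 0 → d j ≠ 0 → i ≠ j → e i ≠ e j)
    (hsign : ∀ i j, 0 < d i → d j < 0 → e i + 2 ≤ e j ∨ e j + 2 ≤ e i)
    (i : ι) (hi : 0 < d i) (hmax : ∀ j, d j ≠ 0 → e j ≤ e i) :
    (e i : ℤ) < ∑ j, d j * (q : ℤ) ^ e j := by
  -- If `e i = 0`, the truncated difference is harmless: there are no negative terms at all.
  have hlow (j : ι) (hj : d j < 0) : e j < e i - 1 := by
    have := hmax j hj.ne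
    have := hsign i j hi hj
    omega
  have hneg := abs_sum_digit_mul_pow_lt (by omega) (Finset.univ.filter fun j => d j < 0) d e
    (e i - 1)
    (fun j hj l hl h => by
      by_contra hjl
      exact he j l (by simpa using hj : d j < 0).ne (by simpa using hl : d l < 0).ne hjl h)
    (fun j hj => hlow j (Finset.mem_filter.1 hj).2) fun j _ => hd j
  have hpos : (q : ℤ) ^ e i ≤
      ∑ j ∈ Finset.univ.filter (fun j => ¬ d j < 0), d j * (q : ℤ) ^ e j := by
    calc (q : ℤ) ^ e i ≤ d i * (q : ℤ) ^ e i := le_mul_of_one_le_left (by positivity) hi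
      _ ≤ _ := Finset.single_le_sum (f := fun j => d j * (q : ℤ) ^ e j)
        (fun j hj => mul_nonneg (not_lt.1 (Finset.mem_filter.1 hj).2) (by positivity))
        (Finset.mem_filter.2 ⟨Finset.mem_univ i, hi.not_gt⟩)
  rw [← Finset.sum_filter_add_sum_filter_not Finset.univ fun j => d j < 0]
  have hneg' := (abs_lt.1 hneg).1
  generalize (∑ j ∈ Finset.univ.filter (fun j => d j < 0), d j * (q : ℤ) ^ e j) = A at *
  generalize (∑ j ∈ Finset.univ.filter (fun j => ¬ d j < 0), d j * (q : ℤ) ^ e j) = B at *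
  rcases hm : e i with _ | m
  · rw [hm] at hneg' hpos
    simp at hneg' hpos ⊢
    omega
  · rw [hm] at hneg' hpos
    rw [Nat.add_sub_cancel] at hneg'
    have h1 : (m : ℤ) < 2 ^ m := by exact_mod_cast Nat.lt_two_pow_self
    have h2 : (2 : ℤ) ^ m ≤ (q : ℤ) ^ m := pow_le_pow_left₀ (by norm_num) (by exact_mod_cast hq) m
    have h3 : 2 * (q : ℤ) ^ m ≤ (q : ℤ) ^ (m + 1) := by
      rw [pow_succ']
      exact mul_le_mul_of_nonneg_right (by exact_mod_cast hq) (by positivity)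
    push_cast
    omega

/-- Every exponent that occurs in a compact sum is smaller than the absolute value of the sum. -/
theorem lt_abs_sum_digit_mul_pow {ι : Type*} [Fintype ι] {q : ℕ} (hq : 2 ≤ q) (d : ι → ℤ)
    (e : ι → ℕ) (hd : ∀ i, |d i| ≤ (q : ℤ) - 1)
    (he : ∀ i j, d i ≠ 0 → d j ≠ 0 → i ≠ j → e i ≠ e j)
    (hsign : ∀ i j, 0 < d i → d j < 0 → e i + 2 ≤ e j ∨ e j + 2 ≤ e i) (i : ι) (hi : d i ≠ 0) :
    (e i : ℤ) < |∑ j, d j * (q : ℤ) ^ e j| := by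
  obtain ⟨t, ht, hmax⟩ := Finset.exists_max_image (Finset.univ.filter fun j => d j ≠ 0) e
    ⟨i, by simpa using hi⟩
  have ht : d t ≠ 0 := (Finset.mem_filter.1 ht).2
  have hmax (j) (hj : d j ≠ 0) : e j ≤ e t := hmax j (by simpa using hj)
  have hit : (e i : ℤ) ≤ e t := by exact_mod_cast hmax i hi
  refine hit.trans_lt ?_
  rcases ht.lt_or_gt with ht | ht
  · have h := lt_sum_digit_mul_pow hq (fun j => -d j) e (by simpa using hd) (by simpa using he)
      (fun j l hj hl => (hsign l j (by omega) (by omega)).symm) t (by omega) (by simpa using hmax)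
    simp only [neg_mul, Finset.sum_neg_distrib] at h
    exact h.trans_le (neg_le_abs _)
  · exact (lt_sum_digit_mul_pow hq d e hd he hsign t ht hmax).trans_le (le_abs_self _)

/-! ### Exponents of nodes -/

theorem abs_digit_le {q : ℕ} (a : Digit q) : |(a : ℤ)| ≤ (q : ℤ) - 1 :=
  abs_le.2 ⟨by linarith [a.2.1], a.2.2⟩

namespace PowerCircuit

variable {q : ℕ} {V : Type*} [Fintype V] (Γ : PowerCircuit q V)

/-- The natural number `e` with `ε(P) = q ^ e`; it is unique for `q ≥ 2`. -/
noncomputable def exponent (P : V) : ℕ := (Γ.nodeEval_mem P).choose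

theorem nodeEval_eq_pow (P : V) : Γ.nodeEval P = (q : ℝ) ^ Γ.exponent P :=
  (Γ.nodeEval_mem P).choose_spec

theorem intEval_eq_sum (M : Marking q V) :
    Γ.intEval M = ∑ Q, (M Q : ℤ) * (q : ℤ) ^ Γ.exponent Q := by
  have h : (Γ.intEval M : ℝ) = ((∑ Q, (M Q : ℤ) * (q : ℤ) ^ Γ.exponent Q : ℤ) : ℝ) := by
    rw [Γ.intEval_cast]
    unfold LabelledDag.markingEval
    push_cast
    exact Finset.sum_congr rfl fun P _ => by rw [Γ.nodeEval_eq_pow]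
  exact_mod_cast h

theorem markingEval_δ (hq : 2 ≤ q) (P : V) : Γ.markingEval (Γ.δ P) = Γ.exponent P := by
  have hq1 : (1 : ℝ) < q := by exact_mod_cast hq
  have h := (Γ.nodeEval_eq P).symm.trans (Γ.nodeEval_eq_pow P)
  rw [← Real.rpow_natCast] at h
  exact (Real.strictMono_rpow_of_base_gt_one hq1).injective h

theorem exponent_eq_sum (hq : 2 ≤ q) (P : V) :
    (Γ.exponent P : ℤ) = ∑ Q, (Γ.δ P Q : ℤ) * (q : ℤ) ^ Γ.exponent Q := by
  rw [← Γ.intEval_eq_sum]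
  have h := (Γ.intEval_cast (Γ.δ P)).trans (Γ.markingEval_δ hq P)
  exact_mod_cast h.symm

variable {Γ}

theorem exponent_ne_of_compactMarking {M : Marking q V} (hM : Γ.CompactMarking M) {P Q : V}
    (hP : (M P : ℤ) ≠ 0) (hQ : (M Q : ℤ) ≠ 0) (hPQ : P ≠ Q) : Γ.exponent P ≠ Γ.exponent Q :=
  fun h => (hM P Q hP hQ hPQ).1 (by rw [Γ.nodeEval_eq_pow, Γ.nodeEval_eq_pow, h])

theorem exponent_lt_abs_sum (hq : 2 ≤ q) {M : Marking q V} (hM : Γ.CompactMarking M) {Q : V}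
    (hQ : (M Q : ℤ) ≠ 0) :
    (Γ.exponent Q : ℤ) < |∑ Q, (M Q : ℤ) * (q : ℤ) ^ Γ.exponent Q| := by
  refine lt_abs_sum_digit_mul_pow hq (fun Q => (M Q : ℤ)) Γ.exponent (fun Q => abs_digit_le _)
    (fun P Q hP hQ hPQ => exponent_ne_of_compactMarking hM hP hQ hPQ) (fun P Q hP hQ => ?_) Q hQ
  have hPQ : P ≠ Q := by
    rintro rfl
    exact hP.not_gt hQ
  have h := (hM P Q hP.ne' hQ.ne hPQ).2 (Or.inr (by
    rw [Int.sign_eq_one_of_pos hP, Int.sign_eq_neg_one_of_neg hQ]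
    decide))
  rw [Γ.markingEval_δ hq, Γ.markingEval_δ hq] at h
  have h' : (2 : ℤ) ≤ |(Γ.exponent P : ℤ) - Γ.exponent Q| := by exact_mod_cast h
  rcases le_abs.1 h' with h' | h' <;> omega

/-- A node with a compact successor marking has exponent `a` if and only if all its successors have
exponents below `a` and the evaluation of its successor marking is `a` modulo `q ^ a`. -/
theorem exponent_eq_iff (hq : 2 ≤ q) {P : V} (hP : Γ.CompactMarking (Γ.δ P)) (a : ℕ) :
    Γ.exponent P = a ↔ (∀ Q, (Γ.δ P Q : ℤ) ≠ 0 → Γ.exponent Q < a) ∧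
      ∑ Q, ((Γ.δ P Q : ℤ) : ZMod (q ^ a)) * (q : ZMod (q ^ a)) ^ min (Γ.exponent Q) a = a := by
  -- The truncation of the exponents does not affect the sum.
  have hsum (h : ∀ Q, (Γ.δ P Q : ℤ) ≠ 0 → Γ.exponent Q < a) :
      ∑ Q, ((Γ.δ P Q : ℤ) : ZMod (q ^ a)) * (q : ZMod (q ^ a)) ^ min (Γ.exponent Q) a =
        Γ.exponent P := by
    rw [← Int.cast_natCast (Γ.exponent P), Γ.exponent_eq_sum hq P]
    push_cast
    refine Finset.sum_congr rfl fun Q _ => ?_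
    by_cases hQ : (Γ.δ P Q : ℤ) = 0
    · simp [hQ]
    · rw [min_eq_left (h Q hQ).le]
  constructor
  · rintro rfl
    have h : ∀ Q, (Γ.δ P Q : ℤ) ≠ 0 → Γ.exponent Q < Γ.exponent P := fun Q hQ => by
      have h1 := exponent_lt_abs_sum hq hP hQ
      rw [← Γ.exponent_eq_sum hq P, Nat.abs_cast] at h1
      exact_mod_cast h1
    exact ⟨h, hsum h⟩
  · rintro ⟨h, h'⟩
    rw [hsum h, ZMod.natCast_eq_natCast_iff'] at h'
    have h1 : Γ.exponent P < q ^ a := by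
      have h2 := abs_sum_digit_mul_pow_lt (by omega)
        (Finset.univ.filter fun Q => (Γ.δ P Q : ℤ) ≠ 0) (fun Q => (Γ.δ P Q : ℤ)) Γ.exponent a
        (fun Q hQ R hR hQR => by
          by_contra hne
          exact exponent_ne_of_compactMarking hP (by simpa using hQ) (by simpa using hR) hne hQR)
        (fun Q hQ => h Q (Finset.mem_filter.1 hQ).2) fun Q _ => abs_digit_le _
      rw [Finset.sum_filter_of_ne fun Q _ hQ => left_ne_zero_of_mul hQ,
        ← Γ.exponent_eq_sum hq P, Nat.abs_cast] at h2
      exact_mod_cast h2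
    rwa [Nat.mod_eq_of_lt h1, Nat.mod_eq_of_lt (Nat.lt_pow_self (by omega))] at h'

end PowerCircuit

/-! ### Residues of evaluations are definable -/

open TC

variable {q : ℕ} {bits : ∀ n, ReducedPowerCircuit q n × Marking q (Fin n) → ℕ → Bool}

/-- Deciding the values below `a` amounts to computing the truncation at `a`. -/
theorem definableFun_min {X : ℕ → Type*} {bits : ∀ n, X n → ℕ → Bool} {J : ℕ → Type*}
    {g : ∀ n, J n → X n → ℕ} (a : ℕ) (h : ∀ b < a, Definable bits fun n j x => g n j x = b) :
    DefinableFun bits fun n j x => (⟨min (g n j x) a, by omega⟩ : Fin (a + 1)) := by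
  intro c
  rcases (Nat.lt_succ_iff.1 c.2).lt_or_eq with hc | hc
  · exact (h c hc).congr fun n j x => by
      rw [Fin.ext_iff]
      change _ ↔ min _ _ = _
      omega
  · refine (Definable.exists_finset (Finset.range a) fun b hb =>
      h b (Finset.mem_range.1 hb)).not.congr fun n j x => ?_
    rw [Fin.ext_iff]
    change _ ↔ min _ _ = _
    simp
    omega

/-- Whether a node has a given exponent is definable. The recursion only goes through the
exponents below the given one, hence through a constant number of rounds. -/
theorem definable_exponent_eq (hq : 2 ≤ q)
    (hδ : DefinableFun bits fun n (p : Fin n × Fin n) x => x.1.δ p.1 p.2) (a : ℕ) :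
    Definable bits fun n (P : Fin n) x => x.1.exponent P = a := by
  induction a using Nat.strong_induction_on with
  | _ a ih =>
    have : NeZero (q ^ a) := ⟨by positivity⟩
    have htr := (definableFun_min a ih).reindex (J' := fun n => Fin n × Fin n) fun n p => p.2
    have hlt : Definable bits fun n (P : Fin n) x =>
        ∀ Q, (x.1.δ P Q : ℤ) ≠ 0 → x.1.exponent Q < a :=
      Definable.forall_fin (J := fun n => Fin n) (φ := fun n (p : Fin n × Fin n)
          (x : ReducedPowerCircuit q n × Marking q (Fin n)) =>
          (x.1.δ p.1 p.2 : ℤ) ≠ 0 → x.1.exponent p.2 < a)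
        ((hδ.comp₂ htr fun d t => (d : ℤ) ≠ 0 → (t : ℕ) < a) True |>.congr fun n p x => by
          simp)
    have hsum : DefinableFun bits fun n (P : Fin n) x => ∑ Q,
        ((x.1.δ P Q : ℤ) : ZMod (q ^ a)) * (q : ZMod (q ^ a)) ^ min (x.1.exponent Q) a :=
      DefinableFun.sum_fin (J := fun n => Fin n) (g := fun n (p : Fin n × Fin n)
          (x : ReducedPowerCircuit q n × Marking q (Fin n)) =>
          ((x.1.δ p.1 p.2 : ℤ) : ZMod (q ^ a)) * (q : ZMod (q ^ a)) ^ min (x.1.exponent p.2) a)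
        (hδ.comp₂ htr fun d t => ((d : ℤ) : ZMod (q ^ a)) * (q : ZMod (q ^ a)) ^ (t : ℕ))
    exact (hlt.and (hsum a)).congr fun n P x =>
      (PowerCircuit.exponent_eq_iff hq (x.1.compact P) a).symm

/-- The powers of an element modulo `k ≥ 2` are eventually periodic with a period less than `k`:
either some power vanishes, or they take at most `k - 1` values. -/
theorem exists_period_lt {k : ℕ} (hk : 2 ≤ k) (b : ZMod k) :
    ∃ t l : ℕ, 0 < l ∧ l < k ∧ ∀ a, t ≤ a → b ^ (a + l) = b ^ a := by
  have : NeZero k := ⟨by omega⟩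
  by_cases h0 : ∃ i, b ^ i = 0
  · obtain ⟨i, hi⟩ := h0
    refine ⟨i, 1, one_pos, hk, fun a ha => ?_⟩
    rw [pow_eq_zero_of_le ha hi, pow_eq_zero_of_le (ha.trans (Nat.le_succ a)) hi]
  · push Not at h0
    have hcard : (Finset.univ.erase (0 : ZMod k)).card < (Finset.range k).card := by
      rw [Finset.card_erase_of_mem (Finset.mem_univ _), Finset.card_univ, ZMod.card,
        Finset.card_range]
      omega
    obtain ⟨i, hi, j, hj, hij, h⟩ := Finset.exists_ne_map_eq_of_card_lt_of_maps_to hcard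
      (f := fun i => b ^ i) fun i _ => by simpa using h0 i
    wlog hlt : i < j generalizing i j
    · exact this j hj i hi hij.symm h.symm (by omega)
    have := Finset.mem_range.1 hj
    refine ⟨i, j - i, by omega, by omega, fun a ha => ?_⟩
    obtain ⟨c, rfl⟩ := Nat.exists_eq_add_of_le ha
    rw [show i + c + (j - i) = j + c by omega, pow_add, pow_add]
    exact congrArg (· * b ^ c) h.symm

theorem pow_eq_of_period {R : Type*} [Monoid R] {b : R} {t l : ℕ}
    (h : ∀ a, t ≤ a → b ^ (a + l) = b ^ a) {e : ℕ} (he : t ≤ e) :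
    b ^ e = b ^ (t + (e - t) % l) := by
  have hj (a j : ℕ) (ha : t ≤ a) : b ^ (a + l * j) = b ^ a := by
    induction j with
    | zero => simp
    | succ j ih => rw [Nat.mul_succ, ← add_assoc, h _ (by omega), ih]
  rw [← hj (t + (e - t) % l) ((e - t) / l) (by omega), add_assoc, Nat.mod_add_div]
  congr 1
  omega

/-- The residues of the node evaluations modulo `k` are definable. They are determined by the
exponents below a constant and by the residues of the exponents modulo a period `l < k`; the latter
are evaluations of markings, so the recursion passes from `k` to `l`. -/
theorem definableFun_nodeEval_mod (hq : 2 ≤ q)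
    (hδ : DefinableFun bits fun n (p : Fin n × Fin n) x => x.1.δ p.1 p.2) (k : ℕ) (hk : 0 < k) :
    DefinableFun bits fun n (P : Fin n) x => (q : ZMod k) ^ x.1.exponent P := by
  induction k using Nat.strong_induction_on with
  | _ k ih =>
    rcases (Nat.succ_le_iff.2 hk).eq_or_lt with rfl | hk
    · exact (definableFun_const (0 : ZMod 1)).congr fun n P x => Subsingleton.elim _ _
    · obtain ⟨t, l, hl, hlk, h⟩ := exists_period_lt hk (q : ZMod k)
      have : NeZero l := ⟨hl.ne'⟩
      have : NeZero k := ⟨by omega⟩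
      have hmod : DefinableFun bits fun n (P : Fin n) x => (x.1.exponent P : ZMod l) :=
        (DefinableFun.sum_fin (J := fun n => Fin n) (g := fun n (p : Fin n × Fin n)
          (x : ReducedPowerCircuit q n × Marking q (Fin n)) =>
            ((x.1.δ p.1 p.2 : ℤ) : ZMod l) * (q : ZMod l) ^ x.1.exponent p.2)
          (hδ.comp₂ ((ih l hlk hl).reindex (J' := fun n => Fin n × Fin n) fun n p => p.2)
            fun d r => ((d : ℤ) : ZMod l) * r)).congr fun n P x => by
          rw [← Int.cast_natCast (x.1.exponent P), x.1.exponent_eq_sum hq P]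
          push_cast
          rfl
      have htr := definableFun_min (bits := bits) t fun b _ => definable_exponent_eq hq hδ b
      refine (htr.comp₂ hmod fun c r => if (c : ℕ) < t then (q : ZMod k) ^ (c : ℕ) else
        (q : ZMod k) ^ (t + (r - t).val)).congr fun n P x => ?_
      dsimp only
      split_ifs with hc
      · congr 1
        omega
      · have hte : t ≤ x.1.exponent P := by omega
        rw [pow_eq_of_period h hte, ← Nat.cast_sub hte, ZMod.val_natCast]

theorem definableFun_intEval_mod (hq : 2 ≤ q)
    (hδ : DefinableFun bits fun n (p : Fin n × Fin n) x => x.1.δ p.1 p.2)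
    (hM : DefinableFun bits fun n (p : Fin n) x => x.2 p) (k : ℕ) (hk : 0 < k) :
    DefinableFun bits fun _ (_ : Unit) x => (x.1.intEval x.2 : ZMod k) := by
  have : NeZero k := ⟨hk.ne'⟩
  refine (DefinableFun.sum_fin (J := fun _ => Unit) (g := fun n (p : Unit × Fin n) x =>
      ((x.2 p.2 : ℤ) : ZMod k) * (q : ZMod k) ^ x.1.exponent p.2)
    ((hM.reindex (J' := fun n => Unit × Fin n) fun n p => p.2).comp₂
      ((definableFun_nodeEval_mod hq hδ k hk).reindex (J' := fun n => Unit × Fin n) fun n p => p.2)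
      fun d r => ((d : ℤ) : ZMod k) * r)).congr fun n _ x => ?_
  rw [x.1.intEval_eq_sum]
  push_cast
  rfl

end PC

/-! ### Reading the input word -/

namespace PC

open TC

/-- The number of bits of an encoded digit. -/
def digitLength (q : ℕ) : ℕ := Nat.size (q - 1) + 1

theorem length_encodeDigit {q : ℕ} (a : Digit q) : (encodeDigit q a).length = digitLength q := by
  simp [encodeDigit, digitLength]

theorem encodeDigit_injective (q : ℕ) : Function.Injective (encodeDigit q) := by
  intro a b h
  obtain ⟨h1, h2⟩ := List.cons_eq_cons.1 h
  have h3 := List.ofFn_injective h2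
  have hbit (c : Digit q) (i : ℕ) (hi : Nat.size (q - 1) ≤ i) :
      (c : ℤ).natAbs.testBit i = false := by
    have hc := abs_digit_le c
    rw [Int.abs_eq_natAbs] at hc
    refine Nat.testBit_lt_two_pow ?_
    calc (c : ℤ).natAbs ≤ q - 1 := by omega
      _ < 2 ^ Nat.size (q - 1) := Nat.lt_size_self _
      _ ≤ 2 ^ i := Nat.pow_le_pow_right (by norm_num) hi
  have h4 : (a : ℤ).natAbs = (b : ℤ).natAbs := Nat.eq_of_testBit_eq fun i => by
    by_cases hi : i < Nat.size (q - 1)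
    · exact congrFun h3 ⟨i, hi⟩
    · rw [hbit a i (not_lt.1 hi), hbit b i (not_lt.1 hi)]
  have h5 := decide_eq_decide.1 h1
  exact Subtype.ext (by omega)

theorem length_flatten_ofFn {α : Type*} {n b : ℕ} (f : Fin n → List α)
    (hf : ∀ i, (f i).length = b) : (List.ofFn f).flatten.length = n * b := by
  simp [List.length_flatten, List.map_ofFn, Function.comp_def, hf]

theorem getD_flatten_ofFn {α : Type*} (z : α) {n b : ℕ} (f : Fin n → List α)
    (hf : ∀ i, (f i).length = b) (i : Fin n) {t : ℕ} (ht : t < b) :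
    (List.ofFn f).flatten.getD (i * b + t) z = (f i).getD t z := by
  induction n with
  | zero => exact i.elim0
  | succ n ih =>
    rw [List.ofFn_succ, List.flatten_cons]
    refine Fin.cases ?_ (fun i => ?_) i
    · rw [List.getD_append _ _ _ _ (by simp [hf, ht])]
      simp
    · rw [List.getD_append_right _ _ _ _ (by rw [hf, Fin.val_succ, Nat.succ_mul]; omega), hf,
        ← ih (fun i => f i.succ) (fun i => hf _) i, Fin.val_succ, Nat.succ_mul]
      congr 1
      omega

theorem encodeMarking_eq (q : ℕ) {n : ℕ} (M : Marking q (Fin n)) :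
    encodeMarking q M = (List.ofFn fun P => encodeDigit q (M P)).flatten := by
  rw [encodeMarking, List.flatMap_def, List.map_ofFn]
  rfl

theorem length_encodeMarking (q : ℕ) {n : ℕ} (M : Marking q (Fin n)) :
    (encodeMarking q M).length = n * digitLength q := by
  rw [encodeMarking_eq, length_flatten_ofFn _ fun _ => length_encodeDigit _]

/-- The input word of a reduced power circuit with a marking that need not be compact. -/
def inputWord {q n : ℕ} (x : ReducedPowerCircuit q n × Marking q (Fin n)) : List Bool :=
  (List.ofFn fun P : Fin n => encodeMarking q (x.1.δ P)).flatten ++ encodeMarking q x.2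

/-- The bits of the input word, extended by `false`. -/
def inputBits (q n : ℕ) (x : ReducedPowerCircuit q n × Marking q (Fin n)) (i : ℕ) : Bool :=
  (inputWord x).getD i false

theorem length_inputWord {q n : ℕ} (x : ReducedPowerCircuit q n × Marking q (Fin n)) :
    (inputWord x).length = (n * n + n) * digitLength q := by
  rw [inputWord, List.length_append, length_flatten_ofFn _ fun _ => length_encodeMarking _ _,
    length_encodeMarking]
  ring

/-- A digit that stands at a known position of the input word is definable. -/
theorem definableFun_of_encodeDigit {q : ℕ} {X : ℕ → Type*} {bits : ∀ n, X n → ℕ → Bool}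
    {J : ℕ → Type*} {g : ∀ n, J n → X n → Digit q} (pos : ∀ n, J n → ℕ)
    (h : ∀ n j x, ∀ t < digitLength q,
      bits n x (pos n j + t) = (encodeDigit q (g n j x)).getD t false) :
    DefinableFun bits g := by
  intro a
  refine (Definable.forall_finite (ι := Fin (digitLength q)) (φ := fun t n j x =>
    bits n x (pos n j + t) = (encodeDigit q a).getD t false) fun t => ?_).congr
    fun n j x => ⟨fun ha => ?_, ?_⟩
  · have hbit := definable_bit (bits := bits) fun n j => pos n j + t
    cases (encodeDigit q a).getD t false
    · exact hbit.not.congr fun n j x => by simp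
    · exact hbit
  · refine encodeDigit_injective q (List.ext_getElem ?_ fun t ht ht' => ?_)
    · rw [length_encodeDigit, length_encodeDigit]
    · have hd : t < digitLength q := by rwa [length_encodeDigit] at ht
      rw [← List.getD_eq_getElem _ false ht, ← List.getD_eq_getElem _ false ht', ← h n j x t hd]
      exact ha ⟨t, hd⟩
  · rintro rfl t
    exact h n j x t t.2

theorem definableFun_δ (q : ℕ) :
    DefinableFun (inputBits q) fun n (p : Fin n × Fin n) x => x.1.δ p.1 p.2 := by
  refine definableFun_of_encodeDigit
    (fun n p => p.1 * (n * digitLength q) + p.2 * digitLength q) fun n p x t ht => ?_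
  have h2 : (p.2 : ℕ) * digitLength q + t < n * digitLength q := by
    calc (p.2 : ℕ) * digitLength q + t < (p.2 + 1) * digitLength q := by
          rw [Nat.succ_mul]; omega
      _ ≤ n * digitLength q := Nat.mul_le_mul_right _ p.2.2
  have h1 : (p.1 : ℕ) * (n * digitLength q) + (p.2 * digitLength q + t) <
      n * (n * digitLength q) := by
    calc _ < ((p.1 : ℕ) + 1) * (n * digitLength q) := by rw [Nat.succ_mul]; omega
      _ ≤ n * (n * digitLength q) := Nat.mul_le_mul_right _ p.1.2
  rw [inputBits, inputWord, add_assoc, List.getD_append _ _ _ _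
      (by rwa [length_flatten_ofFn _ fun _ => length_encodeMarking _ _]),
    getD_flatten_ofFn false _ (fun _ => length_encodeMarking _ _) p.1 h2, encodeMarking_eq,
    getD_flatten_ofFn false _ (fun _ => length_encodeDigit _) p.2 ht]

theorem definableFun_marking (q : ℕ) :
    DefinableFun (inputBits q) fun n (P : Fin n) x => x.2 P := by
  refine definableFun_of_encodeDigit
    (fun n P => n * (n * digitLength q) + P * digitLength q) fun n P x t ht => ?_
  have h := length_flatten_ofFn (fun P : Fin n => encodeMarking q (x.1.δ P))
    fun _ => length_encodeMarking _ _
  rw [inputBits, inputWord, add_assoc, List.getD_append_right _ _ _ _ (by rw [h]; omega), h,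
    Nat.add_sub_cancel_left, encodeMarking_eq,
    getD_flatten_ofFn false _ (fun _ => length_encodeDigit _) P ht]

end PC

/-! ### Circuits for definable functions -/

namespace TC

/-- A definable function from inputs of length `ℓ n` to words of a fixed length is computed by
circuits of polynomial size and constant depth. Circuits are chosen per input length, so `ℓ` has to
be injective, and `n ≤ ℓ n` turns a bound in `n` into a bound in the length. -/
theorem Definable.exists_circuits {X : ℕ → Type*} {bits : ∀ n, X n → ℕ → Bool} {w : ℕ}
    {φ : ∀ n, Fin w → X n → Prop} (h : Definable bits φ) {ℓ : ℕ → ℕ} (hℓ : Function.Injective ℓ)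
    (hle : ∀ n, n ≤ ℓ n) :
    ∃ (C : ∀ N, Circuit N w) (p : Polynomial ℕ) (d : ℕ),
      (∀ N, (C N).size ≤ p.eval N ∧ (C N).depth ≤ d) ∧
      ∀ n (v : Fin (ℓ n) → Bool) (x : X n), Formula.extend v = bits n x →
        ∃ r : Fin w → Bool, (C (ℓ n)).eval v = List.ofFn r ∧ ∀ j, r j = true ↔ φ n j x := by
  obtain ⟨c, h⟩ := h
  choose F h1 h2 h3 using h
  have key (N : ℕ) : ∃ C : Circuit N w, C.size ≤ N + (w * (N + 2) ^ c + 1) ∧ C.depth ≤ c + 2 ∧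
      ∀ n, ℓ n = N → ∀ v, C.eval v = List.ofFn fun j => (F n j).eval (Formula.extend v) := by
    by_cases hN : ∃ n, ℓ n = N
    · obtain ⟨n, rfl⟩ := hN
      obtain ⟨C, hs, hd, he⟩ := Formula.exists_circuit (ℓ n) w (F n)
      refine ⟨C, ?_, hd.trans (Nat.succ_le_succ
        (Finset.sup_le fun j _ => (h1 n j).trans (Nat.le_succ c))),
        fun m hm v => ?_⟩
      · rw [hs]
        refine Nat.add_le_add_left (Nat.succ_le_succ ?_) _
        calc ∑ j, (F n j).size ≤ ∑ _j : Fin w, (n + 2) ^ c := Finset.sum_le_sum fun j _ => h2 n j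
          _ = w * (n + 2) ^ c := by simp
          _ ≤ w * (ℓ n + 2) ^ c := by gcongr; exact hle n
      · rw [he, hℓ hm]
    · -- A length that does not occur; any small circuit serves.
      obtain ⟨C, hs, hd, -⟩ := Formula.exists_circuit N w fun _ => .bot
      refine ⟨C, ?_, hd.trans (Nat.succ_le_succ
        (Finset.sup_le fun j _ => Nat.le_add_left 1 c)),
        fun n hn => (hN ⟨n, hn⟩).elim⟩
      · rw [hs]
        refine Nat.add_le_add_left (Nat.succ_le_succ ?_) _
        calc ∑ _j : Fin w, Formula.bot.size = w * 1 := by simp [Formula.bot, Formula.size]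
          _ ≤ w * (N + 2) ^ c := Nat.mul_le_mul_left _ (Nat.one_le_pow _ _ (by omega))
  choose C hs hd he using key
  refine ⟨C, .X + (.C w * (.X + 2) ^ c + 1), c + 2, fun N => ⟨?_, hd N⟩, fun n v x hv =>
    ⟨_, he _ n rfl v, fun j => ?_⟩⟩
  · simpa using hs N
  · rw [hv, h3]

end TC

/-- For every fixed base `q ≥ 2` and modulus `k ≥ 2`, computing `ε(M) mod k` from a reduced base-`q`
power circuit and a compact marking `M` on it is in `TC⁰`, where the residue may be written in any
fixed-length format. -/
theorem mainTheorem7 (q : ℕ) (hq : 2 ≤ q) (k : ℕ) (hk : 2 ≤ k)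
    (w : ℕ) (format : ℤ → List Bool)
    (hformat : ∀ r : ℤ, 0 ≤ r → r < (k : ℤ) → (format r).length = w) :
    TC.InTC0 (fun I : PC.MarkedCircuit q => I.encode)
      (fun I : PC.MarkedCircuit q => format (I.Γ.intEval I.M % (k : ℤ))) := by
  have : NeZero k := ⟨by omega⟩
  have hdef : TC.Definable (PC.inputBits q) fun n (j : Fin w) x =>
      (format (x.1.intEval x.2 % (k : ℤ))).getD j false = true :=
    (TC.Definable.exists_finite (ι := ZMod k) (φ := fun r n (j : Fin w)
        (x : PC.ReducedPowerCircuit q n × PC.Marking q (Fin n)) =>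
        (x.1.intEval x.2 : ZMod k) = r ∧ (format r.val).getD j false = true) fun r =>
      (((PC.definableFun_intEval_mod hq (PC.definableFun_δ q) (PC.definableFun_marking q) k
        (by omega)) r).reindex fun n (_ : Fin w) => ()).and
      (TC.definable_index fun _ (j : Fin w) =>
        (format r.val).getD j false = true)).congr fun n j x => by
        rw [exists_eq_left', ZMod.val_intCast]
  have hb : 0 < PC.digitLength q := Nat.succ_pos _
  obtain ⟨C, p, d, hC, hval⟩ := hdef.exists_circuits
    (ℓ := fun n => (n * n + n) * PC.digitLength q)
    (StrictMono.injective fun a b hab => Nat.mul_lt_mul_of_pos_right (by nlinarith) hb)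
    fun n => (Nat.le_add_left n (n * n)).trans (Nat.le_mul_of_pos_right _ hb)
  refine ⟨fun _ => w, C, p, d, hC, fun I => ?_⟩
  have hlen : I.encode.length = (I.n * I.n + I.n) * PC.digitLength q :=
    PC.length_inputWord (I.Γ, I.M)
  have hval' : ∀ N (v : Fin N → Bool), N = (I.n * I.n + I.n) * PC.digitLength q →
      TC.Formula.extend v = PC.inputBits q I.n (I.Γ, I.M) →
      ∃ r : Fin w → Bool, (C N).eval v = List.ofFn r ∧
        ∀ j : Fin w, r j = true ↔
          (format (I.Γ.intEval I.M % (k : ℤ))).getD j false = true := by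
    rintro N v rfl hv
    exact hval I.n v (I.Γ, I.M) hv
  obtain ⟨r, hr, hj⟩ := hval' _ I.encode.get hlen (funext fun i => by
    change _ = I.encode.getD i false
    unfold TC.Formula.extend
    split_ifs with hi
    · exact (List.getD_eq_getElem _ _ hi).symm
    · exact (List.getD_eq_default _ _ (not_lt.1 hi)).symm)
  have hfl := hformat _ (Int.emod_nonneg (I.Γ.intEval I.M) (by omega : (k : ℤ) ≠ 0))
    (Int.emod_lt_of_pos _ (by omega))
  change (C I.encode.length).eval I.encode.get = _
  rw [hr]
  refine List.ext_getElem (by rw [List.length_ofFn, hfl]) fun i hi hi' => ?_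
  rw [List.getElem_ofFn, ← List.getD_eq_getElem _ false hi', Bool.eq_iff_iff]
  exact hj _
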